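/- Let $n\ge 2$, $e_1=(1,0,\dots,0)\in\mathbb{R}^n$ and $H=\{y\in\mathbb{R}^n: y_1=0\}$. Fix a metric on $SO(n)$ that induces the natural topology. For a nonempty compact set $J\subset\mathbb{R}^n\times[0,\infty)$, let $\mathcal{K}''_J$ be the space of all compact sets $K\subset J\times SO(n)$ with full projection onto $J$ (that is, for each $(x,r)\in J$ there is $T\in SO(n)$ with $(x,r,T)\in K$), equipped with the Hausdorff metric. A property holds for a typical $K\in\mathcal{K}''_J$ if it holds for all $K$ in a residual subset of $\mathcal{K}''_J$. Then, for every nonempty compact $J\subset\mathbb{R}^n\times[0,\infty)$ and for a typical $K\in\mathcal{K}''_J$, the set $$A_K=\bigcup_{(x,r,T)\in K}\bigl((x+rT(e_1)+T(H))\setminus\{x\}\bigr)$$ has Lebesgue measure zero. In particular, for every nonempty compact set $C\subset\mathbb{R}^n$ and for a typical $K\in\mathcal{K}''_{C\times\{0\}}$, the set $A_K$ is a Nikodym set for $C$: it has Lebesgue measure zero and, for every $x\in C$, there is an affine hyperplane $P\ni x$ with $P\setminus\{x\}\subset A_K$. -/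

import Mathlib

open MeasureTheory Filter Topology TopologicalSpace

namespace Nikodym

/-- `ℝⁿ` with its Euclidean norm and Lebesgue measure. -/
abbrev E (n : ℕ) : Type := EuclideanSpace ℝ (Fin n)

/-- The rotation group `SO(n)`. This is a type synonym that carries no topology or metric of its own,
so that the metric on it can be chosen freely among those inducing the natural topology. -/
def SO (n : ℕ) : Type := Matrix.specialOrthogonalGroup (Fin n) ℝ

namespace SO

/-- The matrix of a rotation. -/
def toMatrix {n : ℕ} (T : SO n) : Matrix (Fin n) (Fin n) ℝ := T.1

/-- The rotation as a linear map of `ℝⁿ`. -/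
noncomputable def toLin {n : ℕ} (T : SO n) : E n →ₗ[ℝ] E n := Matrix.toEuclideanLin T.toMatrix

end SO

/-- A metric on `SO(n)` induces the natural topology: the one inherited from the space of
`n × n` real matrices. -/
def InducesNaturalTopology (n : ℕ) [MetricSpace (SO n)] : Prop :=
  IsEmbedding (SO.toMatrix : SO n → Matrix (Fin n) (Fin n) ℝ)

/-- `e₁ = (1, 0, …, 0)`. -/
noncomputable def e₁ (n : ℕ) [NeZero n] : E n := EuclideanSpace.single 0 1

/-- The hyperplane `H = {y : y₁ = 0}`. -/
def H (n : ℕ) [NeZero n] : Set (E n) := {y | y 0 = 0}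

/-- The rotated hyperplane `x + r T(e₁) + T(H)`, at distance `r` from `x`. -/
noncomputable def rotatedHyperplane {n : ℕ} [NeZero n] (x : E n) (r : ℝ) (T : SO n) : Set (E n) :=
  (fun y => x + r • T.toLin (e₁ n) + T.toLin y) '' H n

/-- The space of all compact sets `K ⊆ J × SO(n)` with full projection onto `J`: for each
`(x, r) ∈ J` there is `T` with `(x, r, T) ∈ K`. As a subtype of `NonemptyCompacts` it carries the
Hausdorff metric. (For nonempty `J`, such a `K` is automatically nonempty.) -/
abbrev CodeSpace {n : ℕ} [MetricSpace (SO n)] (J : Set (E n × ℝ)) : Type :=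
  {K : NonemptyCompacts (E n × ℝ × SO n) //
    (∀ x r T, (x, r, T) ∈ K → (x, r) ∈ J) ∧ ∀ x r, (x, r) ∈ J → ∃ T, (x, r, T) ∈ K}

/-- A property holds for a typical element of a topological space (in the Baire category sense):
it holds on a residual set. -/
def Typically {X : Type*} [TopologicalSpace X] (P : X → Prop) : Prop :=
  {K : X | P K} ∈ residual X

/-- The union of the sets `(x + r T(e₁) + T(H)) ∖ {x}` over all `(x, r, T) ∈ K`. -/
noncomputable def arrangement {n : ℕ} [NeZero n] (K : Set (E n × ℝ × SO n)) : Set (E n) :=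
  {z | ∃ x r T, (x, r, T) ∈ K ∧ z ∈ rotatedHyperplane x r T \ {x}}

/-- `A` contains a punctured hyperplane through every point of `C`. -/
def ContainsPuncturedHyperplanes {n : ℕ} (C A : Set (E n)) : Prop :=
  ∀ x ∈ C, ∃ P : AffineSubspace ℝ (E n),
    x ∈ P ∧ Module.finrank ℝ P.direction + 1 = n ∧ (P : Set (E n)) \ {x} ⊆ A

/-- `A` is a Nikodym set for `C`: it is Lebesgue null and contains a punctured hyperplane through
every point of `C`. -/
def IsNikodymSet {n : ℕ} (C A : Set (E n)) : Prop :=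
  volume A = 0 ∧ ContainsPuncturedHyperplanes C A

end Nikodym

/-! A point of x + rT(e₁) + T(H) other than x is either the foot x + rT(e₁) with r > 0, or has a
displacement from the foot with some nonzero coordinate. Quantifying this and truncating to balls
covers `arrangement K` by countably many images of K under closed relations with bounded range. For
each of them, "the image has measure < η" is an open condition on K, so only its density is needed.
By compactness density is local (`LocallySmall`): the positions near a code must be recodable by
nearby rotations with image of measure at most η.

Feet can all be turned into one fixed hyperplane, which is null. For the other points, fix w = ±e_j
and a normal u. The hyperplane with normal direction u + τw coding (x, r) is {z : ⟨z,u⟩ + τ⟨z,w⟩ =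
F(τ)}, where F is `supportFun`. So z acts as an affine function of slope ⟨z,w⟩, to be compared with
the graph of F. Near τ = 0 the slope of F is about the w-coordinate of the foot, while the relevant
z have slope larger by about c. Hence F crosses from above to below a segment of intermediate slope
m.

`exists_blind` replaces this segment by many short ones of slope m + ε starting on it, then
iterates. F crosses some segment at every stage. Only slopes in a window of length ε are paid for at
each stage, at cost O(ε²); O(1/ε) stages exhaust the slopes, so the total tends to 0. -/

/-! ### Venetian blinds in the plane -/

namespace Nikodym

/-- A discrete intermediate value theorem: a sequence that starts at a value satisfying `P` and ends
at a value satisfying `Q` has consecutive terms satisfying `P` and `Q`, when `P` or `Q` always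
holds. -/
theorem exists_consecutive {P Q : ℕ → Prop} (h : ∀ j, P j ∨ Q j) {B : ℕ} (hB : 0 < B)
    (h0 : P 0) (h1 : Q B) : ∃ j < B, P j ∧ Q (j + 1) := by
  by_contra! hcon
  have key : ∀ j ≤ B, P j := by
    intro j
    induction j with
    | zero => exact fun _ => h0
    | succ j ih => exact fun hj => (h (j + 1)).resolve_right (hcon j (by lia) (ih (by lia)))
  exact hcon (B - 1) (by lia) (key _ (by lia)) (by rwa [Nat.sub_add_cancel hB])

/-- Venetian blinds. Points `(a, y)` of the plane are regarded as affine functions `τ ↦ a + τ y`.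
Every Lipschitz graph that crosses the segment of slope `m` over `[t, t + d]` meets one of finitely
many short vertical segments, which are such that few affine functions with slope in `[m, M]` meet
any of them. -/
theorem exists_blind (μ : Measure (ℝ × ℝ)) {C Γ Λ ε M : ℝ} (hC : 0 ≤ C) (hε : 0 < ε)
    (hΛ : 0 ≤ Λ) (hM : |M| + Λ ≤ Γ)
    (hμ : ∀ a b t q β : ℝ, a ≤ b → 0 ≤ β →
      μ {p | p.2 ∈ Set.Icc a b ∧ |p.1 + t * p.2 - q| ≤ β} ≤ ENNReal.ofReal (C * (b - a) * β))
    (L : ℕ) : ∀ m t q d : ℝ, 0 < d → |m| + Λ ≤ Γ → m + L * ε = M →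
      ∃ S : Finset (ℝ × ℝ × ℝ),
        (∀ s ∈ S, s.1 ∈ Set.Icc t (t + d) ∧ q - Γ * d ≤ s.2.1 ∧ s.2.2 ≤ q + Γ * d) ∧
        (∀ F : ℝ → ℝ, (∀ x y, |F x - F y| ≤ Λ * |x - y|) → q ≤ F t → F (t + d) ≤ q + m * d →
          ∃ s ∈ S, F s.1 ∈ Set.Icc s.2.1 s.2.2) ∧
        μ {p | p.2 ∈ Set.Icc m M ∧ ∃ s ∈ S, p.1 + s.1 * p.2 ∈ Set.Icc s.2.1 s.2.2} ≤
          ENNReal.ofReal (2 * C * L * ε ^ 2 * d) := by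
  have hΓ : 0 ≤ Γ := by have := abs_nonneg M; linarith
  induction L with
  | zero =>
    intro m t q d hd hm hmM
    have hmM' : m = M := by simpa using hmM
    subst hmM'
    -- Only the slope M is left, a null set of affine functions, so a single vertical segment long
    -- enough to contain `F t` costs nothing.
    refine ⟨{(t, q, q + Γ * d)}, ?_, ?_, ?_⟩
    · simp only [Finset.mem_singleton, forall_eq, Set.mem_Icc]
      refine ⟨⟨le_rfl, by linarith⟩, ?_, le_rfl⟩
      nlinarith
    · intro F hF h1 h2
      refine ⟨_, Finset.mem_singleton_self _, h1, ?_⟩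
      have h3 := hF t (t + d)
      rw [abs_sub_comm t, add_sub_cancel_left, abs_of_pos hd] at h3
      have h4 := (abs_le.1 h3).2
      have h5 : m * d ≤ |m| * d := by gcongr; exact le_abs_self m
      have h6 : (|m| + Λ) * d ≤ Γ * d := by gcongr
      show F t ≤ q + Γ * d
      linarith
    · have h := hμ m m t q (Γ * d) le_rfl (by positivity)
      simp only [sub_self, mul_zero, zero_mul, ENNReal.ofReal_zero] at h
      refine le_trans (measure_mono ?_) (h.trans bot_le)
      rintro ⟨a, y⟩ ⟨hy, s, hs, h1, h2⟩
      rw [Finset.mem_singleton.1 hs] at h1 h2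
      refine ⟨hy, abs_le.2 ⟨?_, ?_⟩⟩
      · dsimp only at h1 h2 ⊢
        have : 0 ≤ Γ * d := by positivity
        linarith
      · dsimp only at h1 h2 ⊢
        linarith
  | succ L ih =>
    intro m t q d hd hm hmM
    have hmM' : m + ε + L * ε = M := by push_cast at hmM; linarith
    have hLε : 0 ≤ L * ε := by positivity
    have hm' : |m + ε| + Λ ≤ Γ := by
      have h1 : |m + ε| ≤ max |m| |M| := abs_le_max_abs_abs (by linarith) (by linarith)
      rcases max_cases |m| |M| with h | h <;> linarith
    -- With B pieces of length δ = d / B, the vertical errors inside a piece total at most 2Γδ ≤ εd.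
    obtain ⟨B, hB⟩ := exists_nat_gt (max 1 (2 * Γ / ε))
    have hB1 : (1 : ℝ) < B := (le_max_left _ _).trans_lt hB
    have hB0 : (0 : ℝ) < B := by linarith
    have hB2 : 2 * Γ ≤ ε * B := by
      have := (le_max_right _ _).trans_lt hB
      rw [div_lt_iff₀ hε] at this
      linarith
    set δ := d / B with hδ
    have hδ0 : 0 < δ := by positivity
    have hBδ : B * δ = d := by rw [hδ]; field_simp
    choose S hS1 hS2 hS3 using fun j : ℕ => ih (m + ε) (t + j * δ) (q + m * (j * δ)) δ hδ0 hm' hmM'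
    have hjδ : ∀ j ∈ Finset.range B, (j : ℝ) * δ + δ ≤ d := by
      intro j hj
      have : (j : ℝ) + 1 ≤ B := by exact_mod_cast Finset.mem_range.1 hj
      nlinarith
    have hmΓ : |m| ≤ Γ := by linarith
    refine ⟨(Finset.range B).biUnion S, ?_, ?_, ?_⟩
    · intro s hs
      obtain ⟨j, hj, hs⟩ := Finset.mem_biUnion.1 hs
      obtain ⟨⟨h1, h2⟩, h3, h4⟩ := hS1 j s hs
      have h5 := hjδ j hj
      have h6 : 0 ≤ j * δ := by positivity
      have h7 : |m * (j * δ)| ≤ Γ * (j * δ) := by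
        rw [abs_mul, abs_of_nonneg h6]; gcongr
      have h8 := abs_le.1 h7
      have h9 : Γ * (j * δ + δ) ≤ Γ * d := by gcongr
      exact ⟨⟨by linarith, by linarith⟩, by linarith, by linarith⟩
    · intro F hF h1 h2
      obtain ⟨j, hj, hP, hQ⟩ := exists_consecutive
        (P := fun j : ℕ => q + m * (j * δ) ≤ F (t + j * δ))
        (Q := fun j : ℕ => F (t + j * δ) ≤ q + m * (j * δ))
        (fun j => le_total _ _) (B := B) (by exact_mod_cast hB0) (by simpa using h1)
        (by simpa [hBδ] using h2)
      obtain ⟨s, hs, hs'⟩ := hS2 j F hF hP (by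
        push_cast at hQ
        have e : t + j * δ + δ = t + (j + 1) * δ := by ring
        rw [e]
        have : 0 ≤ ε * δ := by positivity
        linarith)
      exact ⟨s, Finset.mem_biUnion.2 ⟨j, Finset.mem_range.2 hj, hs⟩, hs'⟩
    -- An affine function of slope in [m, m + ε] meeting any sub-blind is within 2εd of q at t:
    -- drift relative to the segment gives εd, the piece errors another εd. These cost C · ε · 2εd.
    -- Steeper ones are left to the sub-blinds, whose lengths add up to d.
    · have hsub : {p : ℝ × ℝ | p.2 ∈ Set.Icc m M ∧
            ∃ s ∈ (Finset.range B).biUnion S, p.1 + s.1 * p.2 ∈ Set.Icc s.2.1 s.2.2} ⊆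
          {p | p.2 ∈ Set.Icc m (m + ε) ∧ |p.1 + t * p.2 - q| ≤ 2 * ε * d} ∪
          ⋃ j ∈ Finset.range B, {p | p.2 ∈ Set.Icc (m + ε) M ∧
            ∃ s ∈ S j, p.1 + s.1 * p.2 ∈ Set.Icc s.2.1 s.2.2} := by
        rintro ⟨a, y⟩ ⟨⟨hy1, hy2⟩, s, hs, hs1, hs2⟩
        obtain ⟨j, hj, hs⟩ := Finset.mem_biUnion.1 hs
        dsimp only at hy1 hy2 hs1 hs2
        rcases le_total y (m + ε) with hy | hy
        · refine Or.inl ⟨⟨hy1, hy⟩, ?_⟩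
          obtain ⟨⟨h1, h2⟩, h3, h4⟩ := hS1 j s hs
          have h5 := hjδ j hj
          have h6 : 0 ≤ j * δ := by positivity
          have hyΓ : |y| ≤ Γ := by
            have h1 : |y| ≤ max |m| |M| := abs_le_max_abs_abs hy1 hy2
            rcases max_cases |m| |M| with h | h <;> linarith
          have e : a + t * y - q = (a + s.1 * y - (q + m * (j * δ))) + (m - y) * (j * δ)
              - (s.1 - (t + j * δ)) * y := by ring
          have k1 : |a + s.1 * y - (q + m * (j * δ))| ≤ Γ * δ :=
            abs_le.2 ⟨by linarith, by linarith⟩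
          have k2 : |(m - y) * (j * δ)| ≤ ε * d := by
            rw [abs_mul, abs_of_nonneg h6]
            exact mul_le_mul (abs_le.2 ⟨by linarith, by linarith⟩) (by linarith) h6 hε.le
          have k3 : |(s.1 - (t + j * δ)) * y| ≤ δ * Γ := by
            rw [abs_mul]
            exact mul_le_mul (abs_le.2 ⟨by linarith, by linarith⟩) hyΓ (abs_nonneg _) hδ0.le
          have k4 : 2 * Γ * δ ≤ ε * B * δ := by gcongr
          rw [mul_assoc ε, hBδ] at k4
          show |a + t * y - q| ≤ _
          rw [e]
          refine (abs_sub _ _).trans ?_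
          have := abs_add_le (a + s.1 * y - (q + m * (j * δ))) ((m - y) * (j * δ))
          linarith
        · exact Or.inr (Set.mem_biUnion (x := j) hj ⟨⟨hy, hy2⟩, s, hs, hs1, hs2⟩)
      refine (measure_mono hsub).trans ((measure_union_le _ _).trans ?_)
      have h1 := hμ m (m + ε) t q (2 * ε * d) (by linarith) (by positivity)
      have h2 : μ (⋃ j ∈ Finset.range B, {p : ℝ × ℝ | p.2 ∈ Set.Icc (m + ε) M ∧
            ∃ s ∈ S j, p.1 + s.1 * p.2 ∈ Set.Icc s.2.1 s.2.2}) ≤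
          ENNReal.ofReal (2 * C * L * ε ^ 2 * d) := by
        refine (measure_biUnion_finset_le _ _).trans
          ((Finset.sum_le_sum fun j _ => hS3 j).trans ?_)
        rw [Finset.sum_const, Finset.card_range, nsmul_eq_mul, ← ENNReal.ofReal_natCast,
          ← ENNReal.ofReal_mul hB0.le, ← hBδ]
        exact ENNReal.ofReal_le_ofReal (by linarith)
      refine (add_le_add h1 h2).trans ?_
      rw [← ENNReal.ofReal_add (by rw [add_sub_cancel_left]; positivity) (by positivity)]
      refine ENNReal.ofReal_le_ofReal ?_
      push_cast
      linarith

end Nikodym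

/-! ### Category argument: open and dense conditions on codes -/

namespace Nikodym

/-- The set of points related to some element of `K`. -/
def imageUnder {X Z : Type*} (R : Set (X × Z)) (K : Set X) : Set Z :=
  {z | ∃ p ∈ K, (p, z) ∈ R}

/-- The complement is the projection of a closed set along the compact factor `B`. -/
theorem isOpen_setOf_imageUnder_subset {X Z : Type*} [TopologicalSpace X] [TopologicalSpace Z]
    {R : Set (X × Z)} (hR : IsClosed R) {B : Set Z} (hB : IsCompact B)
    (hRB : ∀ p z, (p, z) ∈ R → z ∈ B) {U : Set Z} (hU : IsOpen U) :
    IsOpen {p : X | ∀ z, (p, z) ∈ R → z ∈ U} := by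
  have hc : IsClosed {q : X × B | ((q.1, (q.2 : Z)) ∈ R) ∧ (q.2 : Z) ∉ U} := by
    refine (hR.preimage (by fun_prop : Continuous fun q : X × B => (q.1, (q.2 : Z)))).inter
      (hU.isClosed_compl.preimage (by fun_prop : Continuous fun q : X × B => (q.2 : Z)))
  have : CompactSpace B := isCompact_iff_compactSpace.1 hB
  have h := isClosedMap_fst_of_compactSpace _ hc
  convert h.isOpen_compl using 1
  ext p
  simp only [Set.mem_ofPred_eq, Set.mem_compl_iff, Set.mem_image, Prod.exists, Subtype.exists,
    not_exists]
  constructor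
  · rintro h _ z hz ⟨⟨h1, h2⟩, rfl⟩
    exact h2 (h z h1)
  · intro h z hz
    by_contra hzU
    exact h p z (hRB p z hz) ⟨⟨hz, hzU⟩, rfl⟩

variable {n : ℕ} [MetricSpace (SO n)]

/-- By outer regularity the image lies in an open set of measure < η, and it stays there when K
moves slightly in the Hausdorff metric. -/
theorem isOpen_setOf_volume_imageUnder_lt {J : Set (E n × ℝ)}
    {R : Set ((E n × ℝ × SO n) × E n)} (hR : IsClosed R) {B : Set (E n)} (hB : IsCompact B)
    (hRB : ∀ p z, (p, z) ∈ R → z ∈ B) (η : ENNReal) :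
    IsOpen {K : CodeSpace J | volume (imageUnder R (K.1 : Set (E n × ℝ × SO n))) < η} := by
  rw [isOpen_iff_mem_nhds]
  intro K hK
  obtain ⟨U, hKU, hU, hUη⟩ := Set.exists_isOpen_lt_of_lt _ _ hK
  have hV := isOpen_setOf_imageUnder_subset hR hB hRB hU
  have hO := (NonemptyCompacts.isOpen_subsets_of_isOpen hV).preimage
    (continuous_subtype_val : Continuous fun K : CodeSpace J => K.1)
  filter_upwards [hO.mem_nhds (fun p hp z hz => hKU ⟨p, hp, hz⟩)] with K' hK'
  refine lt_of_le_of_lt (measure_mono ?_) hUη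
  rintro z ⟨p, hp, hz⟩
  exact hK' hp z hz

/-- Near every code, the pairs close to its position can be recoded, with rotations close to its
rotation, so that the points related to the new codes form a set of small measure. -/
def LocallySmall (J : Set (E n × ℝ)) (R : Set ((E n × ℝ × SO n) × E n)) : Prop :=
  ∀ x₀ r₀, (x₀, r₀) ∈ J → ∀ T₀ : SO n, ∀ δ > 0, ∃ ρ > 0, ρ ≤ δ ∧ ∀ η : ENNReal, 0 < η →
    ∃ K : Set (E n × ℝ × SO n), IsCompact K ∧
      (∀ x r T, (x, r, T) ∈ K → (x, r) ∈ J ∧ dist (x, r) (x₀, r₀) ≤ ρ ∧ dist T T₀ ≤ δ) ∧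
      (∀ x r, (x, r) ∈ J → dist (x, r) (x₀, r₀) ≤ ρ → ∃ T, (x, r, T) ∈ K) ∧
      volume (imageUnder R K) ≤ η

theorem dist_code_le {x x' : E n} {r r' : ℝ} {T T' : SO n} {δ : ℝ}
    (h : dist (x, r) (x', r') ≤ δ) (hT : dist T T' ≤ δ) : dist (x, r, T) (x', r', T') ≤ δ := by
  rw [Prod.dist_eq, max_le_iff] at h
  exact max_le h.1 (max_le h.2 hT)

theorem dist_code_lt {x x' : E n} {r r' : ℝ} {T T' : SO n} {δ : ℝ}
    (h : dist (x, r, T) (x', r', T') < δ) : dist (x, r) (x', r') < δ ∧ dist T T' < δ := by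
  rw [Prod.dist_eq, max_lt_iff, Prod.dist_eq, max_lt_iff] at h
  exact ⟨max_lt h.1 h.2.1, h.2.2⟩

/-- Finitely many balls of radii ρ cover `K₀`, and the recodings attached to their centres are
united. As ρ is chosen before η in `LocallySmall`, the number of pieces is known when η is divided
among them. -/
theorem dense_setOf_volume_imageUnder_lt {J : Set (E n × ℝ)}
    {R : Set ((E n × ℝ × SO n) × E n)} (hJR : LocallySmall J R) {η : ENNReal} (hη : 0 < η) :
    Dense {K : CodeSpace J | volume (imageUnder R (K.1 : Set (E n × ℝ × SO n))) < η} := by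
  rw [Metric.dense_iff]
  intro K₀ δ₀ hδ₀
  obtain ⟨δ, hδ, hδδ⟩ : ∃ δ > 0, 2 * δ < δ₀ := ⟨δ₀ / 3, by positivity, by linarith⟩
  have hloc : ∀ a : E n × ℝ × SO n, ∃ ρ > 0, a ∈ K₀.1 → ρ ≤ δ ∧ ∀ η : ENNReal, 0 < η →
      ∃ K : Set (E n × ℝ × SO n), IsCompact K ∧
      (∀ x r T, (x, r, T) ∈ K → (x, r) ∈ J ∧ dist (x, r) (a.1, a.2.1) ≤ ρ ∧ dist T a.2.2 ≤ δ) ∧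
      (∀ x r, (x, r) ∈ J → dist (x, r) (a.1, a.2.1) ≤ ρ → ∃ T, (x, r, T) ∈ K) ∧
      volume (imageUnder R K) ≤ η := by
    rintro ⟨x₀, r₀, T₀⟩
    by_cases ha : (x₀, r₀, T₀) ∈ K₀.1
    · obtain ⟨ρ, hρ, h⟩ := hJR x₀ r₀ (K₀.2.1 _ _ _ ha) T₀ δ hδ
      exact ⟨ρ, hρ, fun _ => h⟩
    · exact ⟨1, one_pos, fun h => absurd h ha⟩
  choose ρ hρ hloc using hloc
  obtain ⟨t, htK, hcov⟩ := K₀.1.isCompact.elim_nhds_subcover (fun a => Metric.ball a (ρ a))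
    (fun a _ => Metric.ball_mem_nhds a (hρ a))
  obtain ⟨η', hη', hη'η⟩ : ∃ η' : ENNReal, 0 < η' ∧ t.card * η' < η := by
    obtain ⟨η₁, h1, h2⟩ := exists_between hη
    refine ⟨η₁ / (t.card + 1), ENNReal.div_pos h1.ne' (by finiteness), lt_of_le_of_lt ?_ h2⟩
    calc (t.card : ENNReal) * (η₁ / (t.card + 1)) ≤ (t.card + 1) * (η₁ / (t.card + 1)) := by
          gcongr; exact le_self_add
      _ = η₁ := ENNReal.mul_div_cancel (by simp) (by finiteness)
  have hpiece : ∀ a : E n × ℝ × SO n, ∃ K : Set (E n × ℝ × SO n), a ∈ K₀.1 → IsCompact K ∧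
      (∀ x r T, (x, r, T) ∈ K →
        (x, r) ∈ J ∧ dist (x, r) (a.1, a.2.1) ≤ ρ a ∧ dist T a.2.2 ≤ δ) ∧
      (∀ x r, (x, r) ∈ J → dist (x, r) (a.1, a.2.1) ≤ ρ a → ∃ T, (x, r, T) ∈ K) ∧
      volume (imageUnder R K) ≤ η' := by
    intro a
    by_cases ha : a ∈ K₀.1
    · obtain ⟨K, hK⟩ := (hloc a ha).2 η' hη'
      exact ⟨K, fun _ => hK⟩
    · exact ⟨∅, fun h => absurd h ha⟩
  choose P hP using hpiece
  have hcover : ∀ p ∈ K₀.1, ∃ a ∈ t, dist p a < ρ a := by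
    intro p hp
    simpa using hcov hp
  have hne : (⋃ a ∈ t, P a).Nonempty := by
    obtain ⟨p, hp⟩ := K₀.1.nonempty
    obtain ⟨a, ha, -⟩ := hcover p hp
    obtain ⟨T, hT⟩ := (hP a (htK a ha)).2.2.1 a.1 a.2.1 (K₀.2.1 _ _ a.2.2 (htK a ha))
      (by simpa using (hρ a).le)
    exact ⟨_, Set.mem_biUnion ha hT⟩
  have hcomp : IsCompact (⋃ a ∈ t, P a) := t.isCompact_biUnion fun a ha => (hP a (htK a ha)).1
  let K : CodeSpace J := ⟨⟨⟨⋃ a ∈ t, P a, hcomp⟩, hne⟩, by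
    refine ⟨?_, ?_⟩
    · intro x r T h
      obtain ⟨a, ha, h⟩ := Set.mem_iUnion₂.1 h
      exact ((hP a (htK a ha)).2.1 x r T h).1
    · intro x r h
      obtain ⟨T, hT⟩ := K₀.2.2 x r h
      obtain ⟨a, ha, hd⟩ := hcover _ hT
      obtain ⟨T', hT'⟩ := (hP a (htK a ha)).2.2.1 x r h (dist_code_lt hd).1.le
      exact ⟨T', Set.mem_biUnion ha hT'⟩⟩
  refine ⟨K, ?_, ?_⟩
  · rw [Metric.mem_ball]
    refine lt_of_le_of_lt ?_ hδδ
    show Metric.hausdorffDist (⋃ a ∈ t, P a) (K₀.1 : Set (E n × ℝ × SO n)) ≤ 2 * δ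
    refine Metric.hausdorffDist_le_of_mem_dist (by positivity) ?_ ?_
    · rintro ⟨x, r, T⟩ h
      obtain ⟨a, ha, h⟩ := Set.mem_iUnion₂.1 h
      obtain ⟨-, h1, h2⟩ := (hP a (htK a ha)).2.1 x r T h
      exact ⟨a, htK a ha, (dist_code_le (h1.trans (hloc a (htK a ha)).1) h2).trans (by linarith)⟩
    · intro p hp
      obtain ⟨a, ha, hd⟩ := hcover p hp
      obtain ⟨T, hT⟩ := (hP a (htK a ha)).2.2.1 a.1 a.2.1 (K₀.2.1 _ _ a.2.2 (htK a ha))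
        (by simpa using (hρ a).le)
      refine ⟨_, Set.mem_biUnion ha hT, ?_⟩
      obtain ⟨-, h1, h2⟩ := (hP a (htK a ha)).2.1 _ _ _ hT
      have h3 : dist a (a.1, a.2.1, T) ≤ δ := by
        rw [dist_comm]
        exact dist_code_le (h1.trans (hloc a (htK a ha)).1) h2
      have := dist_triangle p a (a.1, a.2.1, T)
      have := (hloc a (htK a ha)).1
      linarith
  · refine lt_of_le_of_lt ?_ hη'η
    have : imageUnder R (⋃ a ∈ t, P a) ⊆ ⋃ a ∈ t, imageUnder R (P a) := by
      rintro z ⟨p, hp, hz⟩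
      obtain ⟨a, ha, h⟩ := Set.mem_iUnion₂.1 hp
      exact Set.mem_biUnion ha ⟨p, h, hz⟩
    refine (measure_mono this).trans ((measure_biUnion_finset_le _ _).trans ?_)
    refine (Finset.sum_le_card_nsmul _ _ _ fun a ha => (hP a (htK a ha)).2.2.2).trans ?_
    rw [nsmul_eq_mul]

theorem typically_volume_imageUnder_eq_zero {J : Set (E n × ℝ)}
    {R : Set ((E n × ℝ × SO n) × E n)} (hR : IsClosed R) {B : Set (E n)} (hB : IsCompact B)
    (hRB : ∀ p z, (p, z) ∈ R → z ∈ B) (hJR : LocallySmall J R) :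
    Typically fun K : CodeSpace J =>
      volume (imageUnder R (K.1 : Set (E n × ℝ × SO n))) = 0 := by
  have h : ∀ᶠ K : CodeSpace J in residual _, ∀ N : ℕ,
      volume (imageUnder R (K.1 : Set (E n × ℝ × SO n))) < ((N : ENNReal) + 1)⁻¹ := by
    rw [eventually_countable_forall]
    intro N
    exact residual_of_dense_open (isOpen_setOf_volume_imageUnder_lt hR hB hRB _)
      (dense_setOf_volume_imageUnder_lt hJR (by simp))
  refine h.mono fun K hK => ?_
  by_contra h0
  obtain ⟨N, hN⟩ := ENNReal.exists_inv_nat_lt h0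
  exact absurd (hN.trans (hK N)) (not_lt.2 (ENNReal.inv_le_inv.2 le_self_add))

end Nikodym

/-! ### Reflections, rotations and normals -/

namespace Nikodym

open Matrix in
/-- The matrix of the reflection in the hyperplane orthogonal to `v`. -/
noncomputable def householder {n : ℕ} (v : Fin n → ℝ) : Matrix (Fin n) (Fin n) ℝ :=
  1 - (2 / (v ⬝ᵥ v)) • vecMulVec v v

section Householder

open Matrix

variable {n : ℕ}

theorem transpose_householder (v : Fin n → ℝ) : (householder v)ᵀ = householder v := by
  simp [householder, transpose_vecMulVec]

theorem householder_mulVec (v w : Fin n → ℝ) :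
    householder v *ᵥ w = w - (2 / (v ⬝ᵥ v) * (v ⬝ᵥ w)) • v := by
  simp [householder, sub_mulVec, smul_mulVec, vecMulVec_mulVec, smul_smul]

theorem householder_mul_self {v : Fin n → ℝ} (hv : v ⬝ᵥ v ≠ 0) :
    householder v * householder v = 1 := by
  rw [householder, sub_mul, one_mul, mul_sub, mul_one, smul_mul_smul_comm,
    vecMulVec_mul_vecMulVec, vecMulVec_smul, smul_smul]
  have : 2 / (v ⬝ᵥ v) * (2 / (v ⬝ᵥ v)) * (v ⬝ᵥ v) = 2 / (v ⬝ᵥ v) + 2 / (v ⬝ᵥ v) := by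
    field_simp; norm_num
  rw [this, add_smul]
  abel

theorem det_householder {v : Fin n → ℝ} (hv : v ⬝ᵥ v ≠ 0) : (householder v).det = -1 := by
  have h := det_one_add_replicateCol_mul_replicateRow (ι := Unit) (-(2 / (v ⬝ᵥ v)) • v) v
  rw [← vecMulVec_eq, smul_vecMulVec, neg_smul, ← sub_eq_add_neg] at h
  rw [householder, h, dotProduct_smul, smul_eq_mul]
  field_simp
  norm_num

theorem householder_add_self (v : Fin n → ℝ) : householder (v + v) = householder v := by
  have : v + v = (2 : ℝ) • v := (two_smul ℝ v).symm
  rw [this, householder, householder, vecMulVec_smul, smul_vecMulVec, smul_smul, smul_smul,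
    smul_dotProduct, dotProduct_smul, smul_eq_mul, smul_eq_mul]
  congr 2
  by_cases h : v ⬝ᵥ v = 0
  · simp [h]
  · field_simp

theorem continuousAt_householder {v : Fin n → ℝ} (hv : v ⬝ᵥ v ≠ 0) :
    ContinuousAt householder v := by
  unfold householder
  have h1 : Continuous fun v : Fin n → ℝ => v ⬝ᵥ v := by fun_prop
  have h2 : Continuous fun v : Fin n → ℝ => vecMulVec v v := by fun_prop
  exact continuousAt_const.sub ((continuousAt_const.div h1.continuousAt hv).smul h2.continuousAt)

theorem householder_mul_mem_specialOrthogonalGroup {v w : Fin n → ℝ} (hv : v ⬝ᵥ v ≠ 0)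
    (hw : w ⬝ᵥ w ≠ 0) : householder v * householder w ∈ specialOrthogonalGroup (Fin n) ℝ := by
  rw [mem_specialOrthogonalGroup_iff, mem_orthogonalGroup_iff]
  refine ⟨?_, ?_⟩
  · rw [transpose_mul,
      transpose_householder, transpose_householder, mul_assoc, ← mul_assoc (householder w),
      householder_mul_self hw, one_mul, householder_mul_self hv]
  · rw [det_mul, det_householder hv, det_householder hw]
    norm_num

/-- The reflection along a + b sends a to -b, and the one along b sends -b to b. -/
theorem householder_mul_mulVec {a b : Fin n → ℝ} (ha : a ⬝ᵥ a = 1) (hb : b ⬝ᵥ b = 1)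
    (hab : (a + b) ⬝ᵥ (a + b) ≠ 0) : (householder b * householder (a + b)) *ᵥ a = b := by
  have e1 : (a + b) ⬝ᵥ (a + b) = 2 * (1 + a ⬝ᵥ b) := by
    simp only [add_dotProduct, dotProduct_add, ha, hb, dotProduct_comm b a]; ring
  have e2 : (a + b) ⬝ᵥ a = 1 + a ⬝ᵥ b := by
    simp only [add_dotProduct, ha, dotProduct_comm b a]
  have e3 : 1 + a ⬝ᵥ b ≠ 0 := by
    intro h; rw [e1, h] at hab; simp at hab
  rw [← mulVec_mulVec, householder_mulVec (a + b), e1, e2]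
  have : 2 / (2 * (1 + a ⬝ᵥ b)) * (1 + a ⬝ᵥ b) = 1 := by field_simp
  rw [this, one_smul, sub_add_cancel_left, householder_mulVec, hb, dotProduct_neg, hb]
  norm_num
  rw [two_smul]
  abel

end Householder

section Rotations

variable {n : ℕ}

theorem SO.transpose_mul_self (T : SO n) : T.toMatrix.transpose * T.toMatrix = 1 := by
  have h := (Matrix.mem_specialOrthogonalGroup_iff.1 T.2).1
  rwa [Matrix.mem_orthogonalGroup_iff'] at h

theorem SO.mul_transpose_self (T : SO n) : T.toMatrix * T.toMatrix.transpose = 1 := by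
  have h := (Matrix.mem_specialOrthogonalGroup_iff.1 T.2).1
  rwa [Matrix.mem_orthogonalGroup_iff] at h

theorem SO.abs_toMatrix_le (T : SO n) (i j : Fin n) : |T.toMatrix i j| ≤ 1 := by
  have h := congrFun (congrFun T.transpose_mul_self j) j
  rw [Matrix.mul_apply, Matrix.one_apply_eq] at h
  rw [← sq_le_one_iff_abs_le_one, ← h]
  have := Finset.single_le_sum (f := fun k => T.toMatrix.transpose j k * T.toMatrix k j)
    (fun k _ => mul_self_nonneg (T.toMatrix k j)) (Finset.mem_univ i)
  rw [sq]
  exact this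

theorem SO.inner_toLin (T : SO n) (y z : E n) : inner ℝ (T.toLin y) (T.toLin z) = inner ℝ y z := by
  simp only [EuclideanSpace.inner_eq_star_dotProduct, SO.toLin, Matrix.toEuclideanLin,
    star_trivial]
  simp only [Matrix.ofLp_toLpLin, Matrix.toLin'_apply]
  rw [Matrix.dotProduct_mulVec, ← Matrix.mulVec_transpose, Matrix.mulVec_mulVec,
    T.transpose_mul_self, Matrix.one_mulVec]

theorem SO.surjective_toLin (T : SO n) : Function.Surjective T.toLin := by
  have : Function.Injective T.toLin := by
    rw [injective_iff_map_eq_zero]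
    intro y hy
    have h := T.inner_toLin y y
    rw [hy, inner_zero_left] at h
    exact inner_self_eq_zero.1 h.symm
  exact LinearMap.injective_iff_surjective.1 this

theorem compactSpace_SO [MetricSpace (SO n)] (hm : InducesNaturalTopology n) :
    CompactSpace (SO n) := by
  rw [← isCompact_univ_iff, hm.isCompact_iff]
  have hK : IsCompact (Set.univ.pi fun _ : Fin n => Set.univ.pi fun _ : Fin n =>
      Set.Icc (-1 : ℝ) 1) := isCompact_univ_pi fun _ => isCompact_univ_pi fun _ => isCompact_Icc
  refine hK.of_isClosed_subset ?_ ?_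
  · have : SO.toMatrix '' (Set.univ : Set (SO n)) =
        {A : Matrix (Fin n) (Fin n) ℝ | A * A.transpose = 1 ∧ A.det = 1} := by
      ext A
      constructor
      · rintro ⟨T, -, rfl⟩
        exact ⟨T.mul_transpose_self, (Matrix.mem_specialOrthogonalGroup_iff.1 T.2).2⟩
      · rintro ⟨h1, h2⟩
        refine ⟨⟨A, Matrix.mem_specialOrthogonalGroup_iff.2 ⟨?_, h2⟩⟩, trivial, rfl⟩
        rwa [Matrix.mem_orthogonalGroup_iff]
    rw [this]
    exact (isClosed_eq (by fun_prop) continuous_const).inter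
      (isClosed_eq (by fun_prop) continuous_const)
  · rintro _ ⟨T, -, rfl⟩ i - j -
    exact abs_le.1 (T.abs_toMatrix_le i j)

variable [NeZero n]

/-- The unit normal `T(e₁)` of the rotated hyperplanes. -/
noncomputable def SO.normal (T : SO n) : E n := T.toLin (e₁ n)

theorem SO.normal_apply (T : SO n) (i : Fin n) : T.normal i = T.toMatrix i 0 := by
  simp [SO.normal, SO.toLin, e₁, Matrix.toEuclideanLin, Matrix.ofLp_toLpLin]

theorem SO.inner_normal_self (T : SO n) : inner ℝ T.normal T.normal = (1 : ℝ) := by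
  rw [SO.normal, SO.inner_toLin, e₁]
  simp

theorem SO.norm_normal (T : SO n) : ‖T.normal‖ = 1 := by
  have := T.inner_normal_self
  rw [real_inner_self_eq_norm_sq] at this
  nlinarith [norm_nonneg T.normal]

theorem continuous_normal [MetricSpace (SO n)] (hm : InducesNaturalTopology n) :
    Continuous (SO.normal : SO n → E n) := by
  have h : Continuous fun T : SO n => WithLp.toLp 2 fun i => T.toMatrix i 0 :=
    (PiLp.continuous_toLp 2 _).comp (continuous_pi fun i => hm.continuous.matrix_elem i 0)
  convert h using 2 with T
  ext i
  exact T.normal_apply i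

theorem mem_rotatedHyperplane_iff {x z : E n} {r : ℝ} {T : SO n} :
    z ∈ rotatedHyperplane x r T ↔ inner ℝ (z - x) T.normal = r := by
  have key : ∀ y : E n, inner ℝ (T.toLin y) T.normal = y 0 := by
    intro y
    rw [SO.normal, SO.inner_toLin, e₁, EuclideanSpace.inner_single_right]
    simp
  constructor
  · rintro ⟨y, hy, rfl⟩
    have hy : y 0 = 0 := hy
    have e : x + r • T.toLin (e₁ n) + T.toLin y - x = r • T.normal + T.toLin y := by
      rw [SO.normal]; abel
    dsimp only
    rw [e, inner_add_left, inner_smul_left, SO.inner_normal_self, key, hy]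
    simp
  · intro h
    obtain ⟨y, hy⟩ := T.surjective_toLin (z - x - r • T.normal)
    refine ⟨y, ?_, ?_⟩
    · show y 0 = 0
      rw [← key, hy, inner_sub_left, h, inner_smul_left, SO.inner_normal_self]
      simp
    · dsimp only
      rw [hy, SO.normal]
      abel

/-- Rotating the normal slightly can be achieved by a rotation that is close by. -/
theorem exists_normal_eq [MetricSpace (SO n)] (hm : InducesNaturalTopology n) (T₀ : SO n) {δ : ℝ}
    (hδ : 0 < δ) : ∀ᶠ b in 𝓝 T₀.normal, ‖b‖ = 1 → ∃ T : SO n, dist T T₀ ≤ δ ∧ T.normal = b := by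
  set a : Fin n → ℝ := WithLp.ofLp T₀.normal with ha
  have hdot : ∀ b : E n, ‖b‖ = 1 → WithLp.ofLp b ⬝ᵥ WithLp.ofLp b = 1 := by
    intro b hb
    have := real_inner_self_eq_norm_sq b
    rw [EuclideanSpace.inner_eq_star_dotProduct, hb] at this
    simpa using this
  have haa : a ⬝ᵥ a = 1 := hdot _ T₀.norm_normal
  have haa2 : (a + a) ⬝ᵥ (a + a) ≠ 0 := by
    simp only [add_dotProduct, dotProduct_add, haa]; norm_num
  have hof : ContinuousAt (fun b : E n => WithLp.ofLp b) T₀.normal :=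
    (PiLp.continuous_ofLp 2 _).continuousAt
  -- This is the candidate rotation. At b = a the two reflections coincide and cancel, leaving T₀.
  have h1 : Tendsto (fun b : E n => householder (WithLp.ofLp b) *
      householder (a + WithLp.ofLp b) * T₀.toMatrix) (𝓝 T₀.normal) (𝓝 T₀.toMatrix) := by
    have hb : ContinuousAt (fun b : E n => householder (WithLp.ofLp b)) T₀.normal :=
      ContinuousAt.comp (g := householder) (continuousAt_householder (by rw [← ha, haa]; simp)) hof
    have hab : ContinuousAt (fun b : E n => householder (a + WithLp.ofLp b)) T₀.normal :=
      ContinuousAt.comp (g := householder) (f := fun b : E n => a + WithLp.ofLp b)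
        (continuousAt_householder haa2) (continuousAt_const.add hof)
    have h := (hb.mul hab).mul (continuousAt_const (y := T₀.toMatrix))
    have e : householder a * householder (a + a) * T₀.toMatrix = T₀.toMatrix := by
      rw [householder_add_self, householder_mul_self (by rw [haa]; simp), one_mul]
    rw [ContinuousAt] at h
    simp only [Pi.mul_apply] at h
    rw [← ha, e] at h
    exact h
  have h2 : ∃ V ∈ 𝓝 T₀.toMatrix, SO.toMatrix ⁻¹' V ⊆ Metric.closedBall T₀ δ := by
    have := Metric.closedBall_mem_nhds T₀ hδ
    rwa [hm.nhds_eq_comap, mem_comap] at this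
  obtain ⟨V, hV, hVδ⟩ := h2
  have h3 : ∀ᶠ b : E n in 𝓝 T₀.normal,
      (a + WithLp.ofLp b) ⬝ᵥ (a + WithLp.ofLp b) ≠ 0 := by
    have hc : Continuous fun b : E n => (a + WithLp.ofLp b) ⬝ᵥ (a + WithLp.ofLp b) := by
      have := PiLp.continuous_ofLp 2 (fun _ : Fin n => ℝ)
      fun_prop
    exact hc.continuousAt.eventually_ne haa2
  filter_upwards [h1.eventually hV, h3] with b hb hab hb1
  have hbb := hdot b hb1
  obtain ⟨T, hT⟩ : ∃ T : SO n, T.toMatrix =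
      householder (WithLp.ofLp b) * householder (a + WithLp.ofLp b) * T₀.toMatrix :=
    ⟨⟨_, mul_mem (householder_mul_mem_specialOrthogonalGroup (by rw [hbb]; simp) hab) T₀.2⟩, rfl⟩
  refine ⟨T, hVδ (by rw [Set.mem_preimage, hT]; exact hb), ?_⟩
  ext i
  rw [SO.normal_apply, hT]
  have e : T₀.toMatrix.mulVec (Pi.single 0 1) = a := by
    ext i
    rw [ha, SO.normal_apply]
    simp
  rw [← congrFun (householder_mul_mulVec haa hbb hab) i]
  nth_rw 3 [← e]
  rw [Matrix.mulVec_mulVec, Matrix.mulVec_single_one]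
  rfl

end Rotations

end Nikodym

/-! ### Feet of the perpendiculars -/

namespace Nikodym

variable {n : ℕ}

theorem volume_hyperplane {v x₀ : E n} (hv : v ≠ 0) :
    volume {z : E n | inner ℝ v (z - x₀) = 0} = 0 := by
  have h : {z : E n | inner ℝ v (z - x₀) = 0} = AffineSubspace.mk' x₀ (ℝ ∙ v)ᗮ := by
    ext z
    rw [SetLike.mem_coe, AffineSubspace.mem_mk', Submodule.mem_orthogonal_singleton_iff_inner_right]
    rfl
  rw [h]
  refine Measure.addHaar_affineSubspace _ _ fun htop => hv ?_
  have h1 : v + x₀ ∈ AffineSubspace.mk' x₀ (ℝ ∙ v)ᗮ := by rw [htop]; trivial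
  rw [AffineSubspace.mem_mk', Submodule.mem_orthogonal_singleton_iff_inner_right,
    vsub_eq_sub, add_sub_cancel_right] at h1
  exact inner_self_eq_zero.1 h1

theorem exists_norm_eq_one_inner_eq_zero (hn : 2 ≤ n) (u : E n) :
    ∃ v : E n, ‖v‖ = 1 ∧ inner ℝ u v = 0 := by
  have h : (ℝ ∙ u)ᗮ ≠ ⊥ := by
    intro h
    rw [Submodule.orthogonal_eq_bot_iff] at h
    have h1 := finrank_span_le_card (R := ℝ) ({u} : Set (E n))
    rw [h, finrank_top, finrank_euclideanSpace_fin] at h1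
    simp at h1
    lia
  obtain ⟨v, hv, hv0⟩ := Submodule.exists_mem_ne_zero_of_ne_bot h
  refine ⟨‖v‖⁻¹ • v, ?_, ?_⟩
  · rw [norm_smul, norm_inv, norm_norm, inv_mul_cancel₀ (norm_ne_zero_iff.2 hv0)]
  · rw [inner_smul_right, Submodule.mem_orthogonal_singleton_iff_inner_right.1 hv, mul_zero]

variable [MetricSpace (SO n)]

theorem isCompact_setOf_code_mem [CompactSpace (SO n)] {J : Set (E n × ℝ)} (hJ : IsCompact J) :
    IsCompact {q : E n × ℝ × SO n | (q.1, q.2.1) ∈ J} := by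
  have h := (hJ.prod (isCompact_univ (X := SO n))).image
    (by fun_prop : Continuous fun q : (E n × ℝ) × SO n => (q.1.1, q.1.2, q.2))
  convert h using 1
  ext ⟨x, r, T⟩
  simp

variable [NeZero n]

/-- The normal of a rotation can be turned a little towards a given orthogonal unit vector. -/
theorem exists_rotation_toward (hm : InducesNaturalTopology n) (T₀ : SO n) {δ : ℝ} (hδ : 0 < δ)
    {v : E n} (hv1 : ‖v‖ = 1) (hv2 : inner ℝ T₀.normal v = 0) :
    ∃ γ > 0, ∀ τ : ℝ, |τ| ≤ γ →
      ∃ T : SO n, dist T T₀ ≤ δ ∧ T.normal = √(1 - τ ^ 2) • T₀.normal + τ • v := by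
  have h1 : ContinuousAt (fun τ : ℝ => √(1 - τ ^ 2) • T₀.normal + τ • v) 0 :=
    Continuous.continuousAt (by fun_prop)
  have h2 := exists_normal_eq hm T₀ hδ
  have e : √(1 - (0 : ℝ) ^ 2) • T₀.normal + (0 : ℝ) • v = T₀.normal := by simp
  rw [ContinuousAt, e] at h1
  obtain ⟨γ, hγ, h3⟩ := Metric.eventually_nhds_iff.1 (h1.eventually h2)
  refine ⟨min (γ / 2) 1, by positivity, fun τ hτ => h3 ?_ ?_⟩
  · rw [dist_zero_right, Real.norm_eq_abs]
    have := hτ.trans (min_le_left _ _)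
    linarith
  · have hτ1 : τ ^ 2 ≤ 1 := (sq_le_one_iff_abs_le_one _).2 (hτ.trans (min_le_right _ _))
    have h4 : ‖√(1 - τ ^ 2) • T₀.normal + τ • v‖ * ‖√(1 - τ ^ 2) • T₀.normal + τ • v‖ = 1 := by
      rw [norm_add_sq_eq_norm_sq_add_norm_sq_real (by
        rw [inner_smul_left, inner_smul_right, hv2]; simp), norm_smul, norm_smul,
        T₀.norm_normal, hv1, mul_one, mul_one, Real.norm_eq_abs, Real.norm_eq_abs,
        abs_mul_abs_self, abs_mul_abs_self, Real.mul_self_sqrt (by linarith)]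
      ring
    nlinarith [norm_nonneg (√(1 - τ ^ 2) • T₀.normal + τ • v)]

/-- The foot of the perpendicular from `x` to the hyperplane, for codes with `c ≤ r`, within a
ball. -/
def footRelation (n : ℕ) [NeZero n] (c R : ℝ) : Set ((E n × ℝ × SO n) × E n) :=
  {q | q.2 = q.1.1 + q.1.2.1 • q.1.2.2.normal ∧ c ≤ q.1.2.1 ∧ q.2 ∈ Metric.closedBall 0 R}

theorem isClosed_footRelation (hm : InducesNaturalTopology n) (c R : ℝ) :
    IsClosed (footRelation n c R) := by
  have := continuous_normal hm
  have h : Continuous fun q : (E n × ℝ × SO n) × E n => q.1.1 + q.1.2.1 • q.1.2.2.normal := by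
    fun_prop
  have h' : Continuous fun q : (E n × ℝ × SO n) × E n => q.1.2.1 := by fun_prop
  exact (isClosed_eq continuous_snd h).inter ((isClosed_le continuous_const h').inter
    (Metric.isClosed_closedBall.preimage continuous_snd))

/-- If r₀ < c, nearby codes have r < c and no related foot. If r₀ ≥ c, a slight turn of the normal
towards v puts the foot into the null hyperplane through x₀ orthogonal to v. Either way the image is
null, whatever η is. -/
theorem locallySmall_footRelation (hn : 2 ≤ n) (hm : InducesNaturalTopology n)
    {J : Set (E n × ℝ)} (hJ : IsCompact J) {c : ℝ} (hc : 0 < c) (R : ℝ) :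
    LocallySmall J (footRelation n c R) := by
  have := compactSpace_SO hm
  have hcont := continuous_normal hm
  intro x₀ r₀ h₀ T₀ δ hδ
  rcases lt_or_ge r₀ c with hr | hr
  · refine ⟨min δ ((c - r₀) / 2), lt_min hδ (by linarith), min_le_left _ _, fun η _ =>
      ⟨{q | (q.1, q.2.1) ∈ J ∩ Metric.closedBall (x₀, r₀) (min δ ((c - r₀) / 2))} ∩
        {q | q.2.2 = T₀}, ?_, ?_, ?_, ?_⟩⟩
    · exact (isCompact_setOf_code_mem (hJ.inter_right Metric.isClosed_closedBall)).inter_right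
        (isClosed_eq (by fun_prop) continuous_const)
    · rintro x r T ⟨⟨h1, h2⟩, h3⟩
      have h3 : T = T₀ := h3
      exact ⟨h1, h2, by rw [h3, dist_self]; exact hδ.le⟩
    · intro x r h1 h2
      exact ⟨T₀, ⟨h1, h2⟩, rfl⟩
    · refine le_trans (le_of_eq (measure_mono_null ?_ measure_empty)) zero_le
      rintro z ⟨⟨x, r, T⟩, ⟨⟨-, h2⟩, -⟩, -, h3, -⟩
      rw [Metric.mem_closedBall, Prod.dist_eq, max_le_iff] at h2
      have h4 := h2.2.trans (min_le_right _ _)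
      rw [Real.dist_eq] at h4
      have := (abs_le.1 h4).2
      exfalso
      dsimp only at h3 this
      linarith
  · obtain ⟨v, hv1, hv2⟩ := exists_norm_eq_one_inner_eq_zero hn T₀.normal
    have hv0 : v ≠ 0 := by rintro rfl; simp at hv1
    obtain ⟨γ, hγ, hlift⟩ := exists_rotation_toward hm T₀ hδ hv1 hv2
    set ρ := min δ (min (c / 2) (γ * c / 2)) with hρ
    have hρ0 : 0 < ρ := by positivity
    refine ⟨ρ, hρ0, min_le_left _ _, fun η _ =>
      ⟨{q | (q.1, q.2.1) ∈ J ∩ Metric.closedBall (x₀, r₀) ρ} ∩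
        ({q | dist q.2.2 T₀ ≤ δ} ∩ {q | inner ℝ v (q.1 + q.2.1 • q.2.2.normal - x₀) = 0}),
        ?_, ?_, ?_, ?_⟩⟩
    · exact (isCompact_setOf_code_mem (hJ.inter_right Metric.isClosed_closedBall)).inter_right
        ((isClosed_le (by fun_prop) continuous_const).inter
          (isClosed_eq (by fun_prop) continuous_const))
    · rintro x r T ⟨⟨h1, h2⟩, h3, -⟩
      exact ⟨h1, h2, h3⟩
    · intro x r h1 h2
      have h3 := h2
      rw [Prod.dist_eq, max_le_iff, Real.dist_eq, dist_eq_norm] at h3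
      have h4 : ρ ≤ γ * c / 2 := (min_le_right _ _).trans (min_le_right _ _)
      have h5 : c / 2 ≤ r := by
        have h6 : |r - r₀| ≤ c / 2 := h3.2.trans ((min_le_right _ _).trans (min_le_left _ _))
        have := (abs_le.1 h6).1
        linarith
      have hr0 : 0 < r := by linarith
      have h7 : |inner ℝ v (x - x₀)| ≤ γ * c / 2 := by
        refine (abs_real_inner_le_norm _ _).trans ?_
        rw [hv1, one_mul]
        exact h3.1.trans h4
      -- This τ solves ⟨v, x - x₀⟩ + rτ = 0; since r ≥ c / 2, it is at most γ in absolute value.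
      obtain ⟨T, hT, hTn⟩ := hlift (-inner ℝ v (x - x₀) / r) (by
        rw [abs_div, abs_neg, abs_of_pos hr0, div_le_iff₀ hr0]
        nlinarith)
      refine ⟨T, ⟨h1, h2⟩, hT, ?_⟩
      show inner ℝ v (x + r • T.normal - x₀) = 0
      have e : x + r • T.normal - x₀ = (x - x₀) + r • T.normal := by abel
      rw [e, hTn, inner_add_right, inner_smul_right, inner_add_right, inner_smul_right,
        inner_smul_right, real_inner_comm T₀.normal v, hv2, real_inner_self_eq_norm_sq, hv1]
      field_simp
      ring
    · refine le_trans (le_of_eq (measure_mono_null ?_ (volume_hyperplane (x₀ := x₀) hv0))) zero_le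
      rintro z ⟨⟨x, r, T⟩, ⟨-, -, h1⟩, h2, -, -⟩
      have h2 : z = x + r • T.normal := h2
      rw [h2]
      exact h1

end Nikodym

/-! ### Volume of intersections of slabs -/

namespace Nikodym

variable {n : ℕ}

/-- The part of a ball between two pairs of parallel hyperplanes has volume at most a constant times
the product of the widths, uniformly in the shear `t`. -/
theorem exists_volume_slab_le {u : E n} {i j : Fin n} (hij : i ≠ j) (hu : u i ≠ 0) {s : ℝ}
    (hs : s * s = 1) {R : ℝ} (hR : 0 ≤ R) :
    ∃ C : ℝ, 0 ≤ C ∧ ∀ a b t q β : ℝ, a ≤ b → 0 ≤ β →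
      volume ({z : E n | inner ℝ z (EuclideanSpace.single j s) ∈ Set.Icc a b ∧
        |inner ℝ z u + t * inner ℝ z (EuclideanSpace.single j s) - q| ≤ β} ∩
          Metric.closedBall 0 R) ≤ ENNReal.ofReal (C * (b - a) * β) := by
  have hji : j ∈ Finset.univ.erase i := by simp [hij.symm]
  set D : ℝ := ∏ _k ∈ (Finset.univ.erase i).erase j, (R - -R) with hD
  have hD0 : 0 ≤ D := Finset.prod_nonneg fun _ _ => by linarith
  refine ⟨|(u i)⁻¹| * 2 * D, by positivity, fun a b t q β hab hβ => ?_⟩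
  set v : Fin n → ℝ := WithLp.ofLp u + Pi.single j (t * s) with hv
  -- A replaces the i-th coordinate of z by ⟨z,u⟩ + t⟨z,w⟩, mapping the set into a box. Its
  -- determinant `u i` does not involve t, hence the uniform constant.
  set A : Matrix (Fin n) (Fin n) ℝ := 1 + Matrix.replicateCol Unit (Pi.single i (1 : ℝ)) *
    Matrix.replicateRow Unit (v - Pi.single i (1 : ℝ)) with hA
  have hdet : A.det = u i := by
    rw [hA, Matrix.det_one_add_replicateCol_mul_replicateRow]
    simp [hv, hij]
  have hAz : ∀ z : Fin n → ℝ, A.mulVec z = Function.update z i (v ⬝ᵥ z) := by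
    intro z
    rw [hA, ← Matrix.vecMulVec_eq, Matrix.add_mulVec, Matrix.one_mulVec, Matrix.vecMulVec_mulVec,
      sub_dotProduct, single_one_dotProduct]
    ext k
    by_cases hk : k = i
    · subst hk; simp
    · simp [hk]
  set m := s * ((a + b) / 2) with hmdef
  set lo : Fin n → ℝ := Function.update (Function.update (fun _ => -R) j (m - (b - a) / 2)) i
    (q - β) with hlo
  set hi : Fin n → ℝ := Function.update (Function.update (fun _ => R) j (m + (b - a) / 2)) i
    (q + β) with hhi
  have hvol : volume (Set.Icc lo hi) = ENNReal.ofReal (2 * D * (b - a) * β) := by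
    rw [Real.volume_Icc_pi, ← Finset.mul_prod_erase _ _ (Finset.mem_univ i),
      ← Finset.mul_prod_erase _ _ hji]
    have e : ∏ k ∈ (Finset.univ.erase i).erase j, ENNReal.ofReal (hi k - lo k) =
        ENNReal.ofReal D := by
      rw [hD, ENNReal.ofReal_prod_of_nonneg fun _ _ => by linarith]
      refine Finset.prod_congr rfl fun k hk => ?_
      have hkj : k ≠ j := Finset.ne_of_mem_erase hk
      have hki : k ≠ i := Finset.ne_of_mem_erase (Finset.mem_of_mem_erase hk)
      simp [hlo, hhi, hkj, hki]
    have e1 : hi i - lo i = 2 * β := by simp [hlo, hhi]; ring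
    have e2 : hi j - lo j = b - a := by simp [hlo, hhi, hij.symm]
    rw [e, e1, e2, ← ENNReal.ofReal_mul (by linarith), ← ENNReal.ofReal_mul (by linarith)]
    congr 1
    ring
  have hmeas : MeasurableSet (Matrix.toLin' A ⁻¹' Set.Icc lo hi) := by
    have hc : Continuous (Matrix.toLin' A) := LinearMap.continuous_of_finiteDimensional _
    exact (isClosed_Icc.preimage hc).measurableSet
  have hsub : {z : E n | inner ℝ z (EuclideanSpace.single j s) ∈ Set.Icc a b ∧
        |inner ℝ z u + t * inner ℝ z (EuclideanSpace.single j s) - q| ≤ β} ∩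
          Metric.closedBall 0 R ⊆ WithLp.ofLp ⁻¹' (Matrix.toLin' A ⁻¹' Set.Icc lo hi) := by
    rintro z ⟨⟨⟨h1, h2⟩, h3⟩, h4⟩
    have hw : inner ℝ z (EuclideanSpace.single j s) = s * z j := by
      rw [EuclideanSpace.inner_single_right]; simp
    have hvz : v ⬝ᵥ WithLp.ofLp z = inner ℝ z u + t * (s * z j) := by
      rw [hv, add_dotProduct, single_dotProduct, EuclideanSpace.inner_eq_star_dotProduct]
      simp [mul_assoc]
    rw [hw] at h1 h2 h3
    have h3' := abs_le.1 h3
    have hzR : ∀ k, |z k| ≤ R := fun k => by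
      have := (PiLp.norm_apply_le z k).trans (mem_closedBall_zero_iff.1 h4)
      simpa using this
    have hzj : z j = s * (s * z j) := by rw [← mul_assoc, hs, one_mul]
    have hs1 : |s| = 1 := by
      have := abs_mul_abs_self s
      rw [hs] at this
      nlinarith [abs_nonneg s]
    have hj : |z j - m| ≤ (b - a) / 2 := by
      rw [hzj, hmdef, ← mul_sub, abs_mul, hs1, one_mul]
      exact abs_le.2 ⟨by linarith, by linarith⟩
    have hj' := abs_le.1 hj
    have key : ∀ k, lo k ≤ A.mulVec (WithLp.ofLp z) k ∧ A.mulVec (WithLp.ofLp z) k ≤ hi k := by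
      intro k
      rw [hAz, hvz]
      by_cases hki : k = i
      · subst hki
        simp only [hlo, hhi, Function.update_self]
        constructor <;> linarith
      · by_cases hkj : k = j
        · subst hkj
          simp only [hlo, hhi, Function.update_self, Function.update_of_ne hki]
          constructor <;> linarith
        · simp only [hlo, hhi, Function.update_of_ne hki, Function.update_of_ne hkj]
          exact abs_le.1 (hzR k)
    exact ⟨fun k => (key k).1, fun k => (key k).2⟩
  refine (measure_mono hsub).trans ?_
  rw [(PiLp.volume_preserving_ofLp (Fin n)).measure_preimage hmeas.nullMeasurableSet,
    Measure.addHaar_preimage_linearMap _ (by rwa [LinearMap.det_toLin', hdet]),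
    LinearMap.det_toLin', hdet, hvol, ← ENNReal.ofReal_mul (abs_nonneg _)]
  exact ENNReal.ofReal_le_ofReal (le_of_eq (by ring))

end Nikodym

/-! ### Points away from the feet -/

namespace Nikodym

variable {n : ℕ}

theorem norm_single_of_mul_self (j : Fin n) {s : ℝ} (hs : s * s = 1) :
    ‖(EuclideanSpace.single j s : E n)‖ = 1 := by
  rw [EuclideanSpace.norm_eq, Finset.sum_eq_single j (by simp +contextual) (by simp)]
  simp [sq, hs]

theorem norm_add_smul_le {u w : E n} (hu : ‖u‖ = 1) (hw : ‖w‖ = 1) (d : ℝ) :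
    ‖u + d • w‖ ≤ 1 + d * inner ℝ u w + d ^ 2 / 2 := by
  have h : ‖u + d • w‖ ^ 2 = 1 + 2 * (d * inner ℝ u w) + d ^ 2 := by
    rw [norm_add_sq_real, norm_smul, hu, hw, inner_smul_right, Real.norm_eq_abs, mul_one, sq_abs]
    ring
  have : 0 ≤ (‖u + d • w‖ - 1) ^ 2 := sq_nonneg _
  nlinarith

/-- The support function of the spheres `(x, r)` in the direction of the normals `u + τ w`. -/
noncomputable def supportFun (u w x : E n) (r τ : ℝ) : ℝ :=
  inner ℝ x (u + τ • w) + r * ‖u + τ • w‖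

theorem abs_supportFun_sub_le {u w : E n} (hw : ‖w‖ = 1) (x : E n) (r τ τ' : ℝ) :
    |supportFun u w x r τ - supportFun u w x r τ'| ≤ (‖x‖ + |r|) * |τ - τ'| := by
  have e : supportFun u w x r τ - supportFun u w x r τ' =
      inner ℝ x ((τ - τ') • w) + r * (‖u + τ • w‖ - ‖u + τ' • w‖) := by
    have : (τ - τ') • w = (u + τ • w) - (u + τ' • w) := by rw [sub_smul]; abel
    rw [this, inner_sub_right, supportFun, supportFun]
    ring
  have h1 : |(inner ℝ x ((τ - τ') • w) : ℝ)| ≤ ‖x‖ * |τ - τ'| := by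
    have := abs_real_inner_le_norm x ((τ - τ') • w)
    rwa [norm_smul, hw, mul_one, Real.norm_eq_abs] at this
  have h2 : |‖u + τ • w‖ - ‖u + τ' • w‖| ≤ |τ - τ'| := by
    have := abs_norm_sub_norm_le (u + τ • w) (u + τ' • w)
    rwa [add_sub_add_left_eq_sub, ← sub_smul, norm_smul, hw, mul_one, Real.norm_eq_abs] at this
  rw [e]
  refine (abs_add_le _ _).trans ?_
  rw [abs_mul, add_mul]
  gcongr

theorem abs_supportFun_sub_supportFun_le {u w : E n} (hu : ‖u‖ = 1) (hw : ‖w‖ = 1)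
    {x x' : E n} {r r' ρ τ : ℝ} (hx : ‖x - x'‖ ≤ ρ) (hr : |r - r'| ≤ ρ) (hτ : |τ| ≤ 1) :
    |supportFun u w x r τ - supportFun u w x' r' τ| ≤ 4 * ρ := by
  have e : supportFun u w x r τ - supportFun u w x' r' τ =
      inner ℝ (x - x') (u + τ • w) + (r - r') * ‖u + τ • w‖ := by
    rw [supportFun, supportFun, inner_sub_left]
    ring
  have hN : ‖u + τ • w‖ ≤ 2 := by
    refine (norm_add_le _ _).trans ?_
    rw [norm_smul, hu, hw, mul_one, Real.norm_eq_abs]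
    linarith
  have hρ : 0 ≤ ρ := (norm_nonneg _).trans hx
  have h1 : |(inner ℝ (x - x') (u + τ • w) : ℝ)| ≤ ρ * 2 :=
    (abs_real_inner_le_norm _ _).trans (by gcongr)
  have h2 : |(r - r') * ‖u + τ • w‖| ≤ ρ * 2 := by
    rw [abs_mul, abs_norm]; gcongr
  rw [e]
  refine (abs_add_le _ _).trans ?_
  linarith

/-- Venetian blinds of arbitrarily small measure in a family of parallel classes of hyperplanes. -/
theorem exists_blind_lt {u : E n} {i j : Fin n} (hij : i ≠ j) (hu : u i ≠ 0) {s : ℝ}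
    (hs : s * s = 1) {R : ℝ} (hR : 0 ≤ R) {m q d Λ : ℝ} (hd : 0 < d) (hΛ : 0 ≤ Λ)
    {η : ENNReal} (hη : 0 < η) :
    ∃ S : Finset (ℝ × ℝ × ℝ), (∀ s ∈ S, s.1 ∈ Set.Icc 0 d) ∧
      (∀ F : ℝ → ℝ, (∀ x y, |F x - F y| ≤ Λ * |x - y|) → q ≤ F 0 → F d ≤ q + m * d →
        ∃ s ∈ S, F s.1 ∈ Set.Icc s.2.1 s.2.2) ∧
      volume ({z : E n | m ≤ inner ℝ z (EuclideanSpace.single j s) ∧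
        ∃ t ∈ S, inner ℝ z u + t.1 * inner ℝ z (EuclideanSpace.single j s) ∈
          Set.Icc t.2.1 t.2.2} ∩ Metric.closedBall 0 R) ≤ η := by
  obtain ⟨C, hC, hslab⟩ := exists_volume_slab_le hij hu hs hR
  set w : E n := EuclideanSpace.single j s with hw
  have hw1 : ‖w‖ = 1 := norm_single_of_mul_self j hs
  -- Slopes ⟨z,w⟩ of points of the ball are at most R; m + 1 ensures m < M. Taking ε = (M - m) / L
  -- turns the blind bound into A / L.
  set M := max R (m + 1) with hM
  have hmM : 0 < M - m := by have := le_max_right R (m + 1); linarith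
  set A : ℝ := 2 * C * (M - m) ^ 2 * d with hA
  obtain ⟨L, hL0, hL⟩ : ∃ L : ℕ, 0 < L ∧ ENNReal.ofReal (A / L) < η := by
    have h := ENNReal.tendsto_ofReal (tendsto_const_div_atTop_nhds_zero_nat A)
    rw [ENNReal.ofReal_zero] at h
    exact ((eventually_gt_atTop 0).and (h.eventually (gt_mem_nhds hη))).exists
  have hL0' : (0 : ℝ) < L := by exact_mod_cast hL0
  let φ : E n → ℝ × ℝ := fun z => (inner ℝ z u, inner ℝ z w)
  have hφ : Continuous φ := by fun_prop
  have hball : MeasurableSet (Metric.closedBall (0 : E n) R) := Metric.isClosed_closedBall.measurableSet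
  obtain ⟨S, hS1, hS2, hS3⟩ := exists_blind
    (Measure.map φ (volume.restrict (Metric.closedBall 0 R))) (C := C)
    (Γ := |m| + |M| + Λ) (Λ := Λ) (ε := (M - m) / L) (M := M) hC (by positivity) hΛ
    (by have := abs_nonneg m; linarith) (by
      intro a b t q β hab hβ
      have hcl : IsClosed {p : ℝ × ℝ | p.2 ∈ Set.Icc a b ∧ |p.1 + t * p.2 - q| ≤ β} :=
        (isClosed_Icc.preimage continuous_snd).inter
          (isClosed_le (by fun_prop : Continuous fun p : ℝ × ℝ => |p.1 + t * p.2 - q|)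
            continuous_const)
      rw [Measure.map_apply hφ.measurable hcl.measurableSet, Measure.restrict_apply' hball]
      exact hslab a b t q β hab hβ)
    L m 0 q d hd (by have := abs_nonneg M; linarith) (by field_simp; ring)
  simp only [zero_add] at hS1 hS2
  refine ⟨S, fun t ht => (hS1 t ht).1, hS2, ?_⟩
  have hle := (Measure.le_map_apply (μ := volume.restrict (Metric.closedBall 0 R))
    hφ.aemeasurable _).trans hS3
  rw [Measure.restrict_apply' hball] at hle
  refine (measure_mono ?_).trans (hle.trans (le_trans (le_of_eq ?_) hL.le))
  · rintro z ⟨⟨h1, h2⟩, h3⟩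
    refine ⟨⟨⟨h1, ?_⟩, h2⟩, h3⟩
    refine (real_inner_le_norm z w).trans ?_
    rw [hw1, mul_one]
    exact (mem_closedBall_zero_iff.1 h3).trans (le_max_left _ _)
  · congr 1
    rw [hA]
    field_simp

variable [MetricSpace (SO n)]

theorem continuous_supportFun (u w : E n) (τ : ℝ) :
    Continuous fun q : E n × ℝ × SO n => supportFun u w q.1 q.2.1 τ := by
  unfold supportFun
  fun_prop

variable [NeZero n]

/-- The points of the hyperplane whose displacement from the foot of the perpendicular has inner
product at least `c` with `w`, within a ball. -/
def displacementRelation (w : E n) (c R : ℝ) : Set ((E n × ℝ × SO n) × E n) :=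
  {q | inner ℝ (q.2 - q.1.1) q.1.2.2.normal = q.1.2.1 ∧
    c ≤ inner ℝ (q.2 - (q.1.1 + q.1.2.1 • q.1.2.2.normal)) w ∧ q.2 ∈ Metric.closedBall 0 R}

theorem isClosed_displacementRelation (hm : InducesNaturalTopology n) (w : E n) (c R : ℝ) :
    IsClosed (displacementRelation w c R) := by
  have := continuous_normal hm
  have h1 : Continuous fun q : (E n × ℝ × SO n) × E n =>
      (inner ℝ (q.2 - q.1.1) q.1.2.2.normal : ℝ) := by fun_prop
  have h2 : Continuous fun q : (E n × ℝ × SO n) × E n => q.1.2.1 := by fun_prop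
  have h3 : Continuous fun q : (E n × ℝ × SO n) × E n =>
      (inner ℝ (q.2 - (q.1.1 + q.1.2.1 • q.1.2.2.normal)) w : ℝ) := by fun_prop
  exact (isClosed_eq h1 h2).inter ((isClosed_le continuous_const h3).inter
    (Metric.isClosed_closedBall.preimage continuous_snd))

/-- Codes near a given one can be chosen so that the hyperplanes, away from the feet of the
perpendiculars, have small union. -/
theorem exists_recoding (hm : InducesNaturalTopology n)
    {J : Set (E n × ℝ)} (hJ : IsCompact J) (hJ0 : ∀ p ∈ J, 0 ≤ p.2) {i j : Fin n} (hij : i ≠ j)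
    {s : ℝ} (hs : s * s = 1) {c R : ℝ} (hc : 0 < c) (hR : 0 ≤ R) {x₀ : E n} {r₀ : ℝ}
    (h₀ : (x₀, r₀) ∈ J) {T₀ : SO n} (hT₀ : T₀.normal i ≠ 0) {δ : ℝ} (hδ : 0 < δ) :
    ∃ ρ > 0, ρ ≤ δ ∧ ∀ η : ENNReal, 0 < η →
    ∃ K : Set (E n × ℝ × SO n), IsCompact K ∧
      (∀ x r T, (x, r, T) ∈ K → (x, r) ∈ J ∧ dist (x, r) (x₀, r₀) ≤ ρ ∧ dist T T₀ ≤ δ) ∧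
      (∀ x r, (x, r) ∈ J → dist (x, r) (x₀, r₀) ≤ ρ → ∃ T, (x, r, T) ∈ K) ∧
      volume (imageUnder (displacementRelation (EuclideanSpace.single j s) c R) K) ≤ η := by
  have := compactSpace_SO hm
  have hcont := continuous_normal hm
  have hr₀ : 0 ≤ r₀ := hJ0 _ h₀
  set w : E n := EuclideanSpace.single j s with hwdef
  have hw : ‖w‖ = 1 := norm_single_of_mul_self j hs
  set u := T₀.normal with hu
  have hu1 : ‖u‖ = 1 := T₀.norm_normal
  -- Adding multiples of w leaves the nonzero i-th coordinate of u unchanged.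
  have hN : ∀ τ : ℝ, u + τ • w ≠ 0 := by
    intro τ h
    have := congrArg (fun y : E n => y i) h
    simp [hwdef, hij, hT₀] at this
  have hN' : ∀ τ : ℝ, ‖u + τ • w‖ ≠ 0 := fun τ => norm_ne_zero_iff.2 (hN τ)
  obtain ⟨d₁, hd₁, hlift⟩ : ∃ d₁ > 0, ∀ τ : ℝ, |τ| < d₁ →
      (∃ T : SO n, dist T T₀ ≤ δ ∧ T.normal = ‖u + τ • w‖⁻¹ • (u + τ • w)) ∧
      r₀ * ‖‖u + τ • w‖⁻¹ • (u + τ • w) - u‖ < c / 8 := by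
    have h1 : ContinuousAt (fun τ : ℝ => ‖u + τ • w‖⁻¹ • (u + τ • w)) 0 := by
      have hc1 : Continuous fun τ : ℝ => u + τ • w := by fun_prop
      exact (hc1.norm.continuousAt.inv₀ (hN' 0)).smul hc1.continuousAt
    have h2 : ContinuousAt (fun τ : ℝ => r₀ * ‖‖u + τ • w‖⁻¹ • (u + τ • w) - u‖) 0 :=
      continuousAt_const.mul (h1.sub continuousAt_const).norm
    have h3 : ∀ᶠ τ : ℝ in 𝓝 0, r₀ * ‖‖u + τ • w‖⁻¹ • (u + τ • w) - u‖ < c / 8 := by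
      refine h2.eventually (gt_mem_nhds ?_)
      simp only [zero_smul, add_zero, hu1, inv_one, one_smul, sub_self, norm_zero, mul_zero]
      positivity
    have e : ‖u + (0 : ℝ) • w‖⁻¹ • (u + (0 : ℝ) • w) = u := by simp [hu1]
    rw [ContinuousAt, e] at h1
    obtain ⟨γ, hγ, h4⟩ := Metric.eventually_nhds_iff.1
      ((h1.eventually (exists_normal_eq hm T₀ hδ)).and h3)
    refine ⟨γ, hγ, fun τ hτ => ?_⟩
    obtain ⟨h5, h6⟩ := h4 (y := τ) (by simpa using hτ)
    refine ⟨h5 ?_, h6⟩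
    rw [norm_smul, norm_inv, norm_norm, inv_mul_cancel₀ (hN' τ)]
  -- The derivative at τ = 0 of the support function of (x₀, r₀), equal to the w-coordinate of the
  -- foot.
  set σ : ℝ := inner ℝ x₀ w + r₀ * inner ℝ u w with hσ
  obtain ⟨d, hd, hdd, hd1, hrd⟩ : ∃ d > 0, d < d₁ ∧ d ≤ 1 ∧ r₀ * d ≤ c / 2 := by
    refine ⟨min (d₁ / 2) (min 1 (c / (2 * (r₀ + 1)))), by positivity,
      (min_le_left _ _).trans_lt (by linarith), (min_le_right _ _).trans (min_le_left _ _), ?_⟩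
    have h1 : min (d₁ / 2) (min 1 (c / (2 * (r₀ + 1)))) ≤ c / (2 * (r₀ + 1)) :=
      (min_le_right _ _).trans (min_le_right _ _)
    calc r₀ * min (d₁ / 2) (min 1 (c / (2 * (r₀ + 1)))) ≤ (r₀ + 1) * (c / (2 * (r₀ + 1))) := by
          gcongr; linarith
      _ = c / 2 := by field_simp
  set ρ := min (min δ 1) (min (c * d / 32) (c / 8)) with hρ
  have hρ0 : 0 < ρ := by positivity
  have hρδ : ρ ≤ δ := (min_le_left _ _).trans (min_le_left _ _)
  have hρ1 : ρ ≤ 1 := (min_le_left _ _).trans (min_le_right _ _)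
  have hρd : ρ ≤ c * d / 32 := (min_le_right _ _).trans (min_le_left _ _)
  have hρc : ρ ≤ c / 8 := (min_le_right _ _).trans (min_le_right _ _)
  -- The quadratic term r₀d²/2 is at most cd/4, so the support function of (x₀, r₀) clears both ends
  -- of the segment from q of slope m by cd/8. Moving (x, r) by ρ costs at most 4ρ ≤ cd/8.
  set q := supportFun u w x₀ r₀ 0 - c * d / 8 with hq
  set m := σ + c / 2 with hmdef
  have hF0 : supportFun u w x₀ r₀ d ≤ supportFun u w x₀ r₀ 0 + σ * d + c * d / 4 := by
    have h1 := mul_le_mul_of_nonneg_left (norm_add_smul_le hu1 hw d) hr₀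
    have h2 : r₀ * d * d ≤ c / 2 * d := by gcongr
    simp only [supportFun, zero_smul, add_zero, hu1, inner_add_right, inner_smul_right]
    rw [hσ]
    linarith
  refine ⟨ρ, hρ0, hρδ, fun η hη => ?_⟩
  obtain ⟨S, hS1, hS2, hS3⟩ := exists_blind_lt hij hT₀ hs hR (m := m) (q := q) (d := d)
    (Λ := ‖x₀‖ + r₀ + 2) hd (by positivity) hη
  have hSd : ∀ t ∈ S, |t.1| < d₁ := fun t ht => by
    rw [abs_of_nonneg (hS1 t ht).1]
    exact (hS1 t ht).2.trans_lt hdd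
  have hsel : ∀ τ : ℝ, ∃ T : SO n, |τ| < d₁ →
      dist T T₀ ≤ δ ∧ T.normal = ‖u + τ • w‖⁻¹ • (u + τ • w) := by
    intro τ
    by_cases h : |τ| < d₁
    · obtain ⟨T, hT⟩ := (hlift τ h).1
      exact ⟨T, fun _ => hT⟩
    · exact ⟨T₀, fun h' => absurd h' h⟩
  choose T hT using hsel
  have hclose : ∀ x r, dist (x, r) (x₀, r₀) ≤ ρ → ‖x - x₀‖ ≤ ρ ∧ |r - r₀| ≤ ρ := by
    intro x r h
    rwa [Prod.dist_eq, max_le_iff, Real.dist_eq, dist_eq_norm] at h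
  refine ⟨⋃ t ∈ S, {p | (p.1, p.2.1) ∈ J ∩ Metric.closedBall (x₀, r₀) ρ} ∩
    ({p | p.2.2 = T t.1} ∩ {p | supportFun u w p.1 p.2.1 t.1 ∈ Set.Icc t.2.1 t.2.2}),
    ?_, ?_, ?_, ?_⟩
  · refine S.isCompact_biUnion fun t _ => ?_
    exact (isCompact_setOf_code_mem (hJ.inter_right Metric.isClosed_closedBall)).inter_right
      ((isClosed_eq (by fun_prop) continuous_const).inter
        (isClosed_Icc.preimage (continuous_supportFun u w t.1)))
  · intro x r T' h
    obtain ⟨t, ht, ⟨h1, h2⟩, h3, -⟩ := Set.mem_iUnion₂.1 h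
    have h3 : T' = T t.1 := h3
    exact ⟨h1, h2, h3 ▸ (hT t.1 (hSd t ht)).1⟩
  · intro x r h1 h2
    obtain ⟨h3, h4⟩ := hclose x r h2
    obtain ⟨t, ht, hF⟩ := hS2 (supportFun u w x r) (by
        intro τ τ'
        refine (abs_supportFun_sub_le hw x r τ τ').trans ?_
        have h5 : ‖x‖ ≤ ‖x₀‖ + ρ := by
          have := norm_le_norm_add_norm_sub' x x₀
          linarith
        have h6 : |r| ≤ r₀ + ρ := by
          rw [abs_of_nonneg (hJ0 _ h1)]
          have := (abs_le.1 h4).2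
          linarith
        exact mul_le_mul_of_nonneg_right (by linarith) (abs_nonneg _))
      (by
        have := (abs_le.1 (abs_supportFun_sub_supportFun_le hu1 hw h3 h4
          (τ := 0) (by simp))).1
        linarith)
      (by
        have := (abs_le.1 (abs_supportFun_sub_supportFun_le hu1 hw h3 h4
          (τ := d) (by rw [abs_of_pos hd]; exact hd1))).2
        have e : m * d = σ * d + c * d / 2 := by rw [hmdef]; ring
        linarith)
    exact ⟨T t.1, Set.mem_biUnion ht ⟨⟨h1, h2⟩, rfl, hF⟩⟩
  · refine (measure_mono ?_).trans hS3
    rintro z ⟨⟨x, r, T'⟩, hp, h1, h2, h3⟩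
    obtain ⟨t, ht, ⟨hpJ, hpρ⟩, hpT, hpF⟩ := Set.mem_iUnion₂.1 hp
    have hpT : T' = T t.1 := hpT
    dsimp only at h1 h2 h3 hpJ hpF
    obtain ⟨k1, k2⟩ := hclose x r hpρ
    have hTn := (hT t.1 (hSd t ht)).2
    have hsmall := (hlift t.1 (hSd t ht)).2
    rw [hpT] at h1 h2
    refine ⟨⟨?_, t, ht, ?_⟩, h3⟩
    -- The w-coordinate of the foot differs from σ by at most ρ + ρ + c/8 ≤ 3c/8, so the slope of z
    -- is at least σ + 5c/8 ≥ m.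
    · rw [inner_sub_left, inner_add_left, inner_smul_left] at h2
      rw [← hTn] at hsmall
      have hν : ‖(T t.1).normal‖ = 1 := SO.norm_normal _
      have l1 : |(inner ℝ (x - x₀) w : ℝ)| ≤ ρ := by
        refine (abs_real_inner_le_norm _ _).trans ?_
        rw [hw, mul_one]; exact k1
      rw [inner_sub_left] at l1
      have l2 : |(r - r₀) * inner ℝ (T t.1).normal w| ≤ ρ := by
        rw [abs_mul]
        calc |r - r₀| * |(inner ℝ (T t.1).normal w : ℝ)| ≤ ρ * 1 := by
              gcongr
              refine (abs_real_inner_le_norm _ _).trans ?_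
              rw [hw, hν, mul_one]
          _ = ρ := mul_one ρ
      have l3 : |r₀ * (inner ℝ ((T t.1).normal - u) w : ℝ)| ≤ c / 8 := by
        rw [abs_mul, abs_of_nonneg hr₀]
        refine le_trans ?_ hsmall.le
        gcongr
        refine (abs_real_inner_le_norm _ _).trans ?_
        rw [hw, mul_one]
      rw [inner_sub_left] at l3
      have l1' := (abs_le.1 l1).1
      have l2' := (abs_le.1 l2).1
      have l3' := (abs_le.1 l3).1
      simp only [conj_trivial] at h2
      rw [hmdef, hσ]
      nlinarith
    · have h4 : inner ℝ (z - x) (u + t.1 • w) = r * ‖u + t.1 • w‖ := by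
        rw [hTn, inner_smul_right] at h1
        rw [← h1]
        field_simp [hN' t.1]
      have h5 : inner ℝ z u + t.1 * inner ℝ z w = supportFun u w x r t.1 := by
        rw [supportFun, ← h4, ← inner_add_left, add_sub_cancel, inner_add_right, inner_smul_right]
      rw [h5]
      exact hpF

/-- Half of δ is spent on making some coordinate i ≠ j of the normal nonzero, the other half on the
recoding. -/
theorem locallySmall_displacementRelation (hn : 2 ≤ n) (hm : InducesNaturalTopology n)
    {J : Set (E n × ℝ)} (hJ : IsCompact J) (hJ0 : ∀ p ∈ J, 0 ≤ p.2) (j : Fin n)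
    {s : ℝ} (hs : s * s = 1) {c R : ℝ} (hc : 0 < c) (hR : 0 ≤ R) :
    LocallySmall J (displacementRelation (EuclideanSpace.single j s) c R) := by
  intro x₀ r₀ h₀ T₀ δ hδ
  have : Nontrivial (Fin n) := Fin.nontrivial_iff_two_le.2 hn
  obtain ⟨i, hij⟩ := exists_ne j
  obtain ⟨T₁, hT₁, hi⟩ : ∃ T₁ : SO n, dist T₁ T₀ ≤ δ / 2 ∧ T₁.normal i ≠ 0 := by
    by_cases h : T₀.normal i = 0
    · obtain ⟨γ, hγ, h1⟩ := exists_rotation_toward hm T₀ (half_pos hδ)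
        (v := EuclideanSpace.single i (1 : ℝ)) (by simp) (by
          rw [EuclideanSpace.inner_single_right, h]; simp)
      obtain ⟨T, hT, hTn⟩ := h1 γ (abs_of_pos hγ).le
      refine ⟨T, hT, ?_⟩
      rw [hTn]
      simp [h, hγ.ne']
    · exact ⟨T₀, by rw [dist_self]; positivity, h⟩
  obtain ⟨ρ, hρ, hρδ, hK⟩ := exists_recoding hm hJ hJ0 hij hs hc hR h₀ hi (half_pos hδ)
  refine ⟨ρ, hρ, by linarith, fun η hη => ?_⟩
  obtain ⟨K, h1, h2, h3⟩ := hK η hη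
  refine ⟨K, h1, fun x r T h => ?_, h3⟩
  obtain ⟨h4, h5, h6⟩ := h2 x r T h
  exact ⟨h4, h5, (dist_triangle T T₁ T₀).trans (by linarith)⟩

end Nikodym

/-! ### Decomposition of the arrangement and conclusion -/

namespace Nikodym

variable {n : ℕ} [NeZero n]

theorem containsPuncturedHyperplanes_arrangement {C : Set (E n)} {K : Set (E n × ℝ × SO n)}
    (hK : ∀ x ∈ C, ∃ T, (x, (0 : ℝ), T) ∈ K) : ContainsPuncturedHyperplanes C (arrangement K) := by
  intro x hx
  obtain ⟨T, hT⟩ := hK x hx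
  refine ⟨AffineSubspace.mk' x (ℝ ∙ T.normal)ᗮ, AffineSubspace.self_mem_mk' _ _, ?_, ?_⟩
  · rw [AffineSubspace.direction_mk']
    have h0 : T.normal ≠ 0 := by
      intro h
      have := T.norm_normal
      rw [h] at this
      simp at this
    have h := Submodule.finrank_add_finrank_orthogonal (ℝ ∙ T.normal)
    rw [finrank_span_singleton h0, finrank_euclideanSpace_fin] at h
    rw [add_comm]
    exact h
  · rintro z ⟨hz, hzx⟩
    rw [SetLike.mem_coe, AffineSubspace.mem_mk',
      Submodule.mem_orthogonal_singleton_iff_inner_left] at hz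
    exact ⟨x, 0, T, hT, mem_rotatedHyperplane_iff.2 hz, hzx⟩

/-- The puncture matters here: for r = 0 the foot is x itself, so a remaining foot has r > 0. Both
signs of e_j are needed because the displacement bound is one-sided. -/
theorem arrangement_subset {K : Set (E n × ℝ × SO n)} (hK : ∀ x r T, (x, r, T) ∈ K → 0 ≤ r) :
    arrangement K ⊆
      (⋃ k : ℕ, imageUnder (footRelation n (1 / ((k : ℝ) + 1)) k) K) ∪
      ⋃ (j : Fin n) (k : ℕ),
        imageUnder (displacementRelation (EuclideanSpace.single j 1) (1 / ((k : ℝ) + 1)) k) K ∪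
        imageUnder (displacementRelation (EuclideanSpace.single j (-1)) (1 / ((k : ℝ) + 1)) k) K := by
  rintro z ⟨x, r, T, hT, hz, hzx⟩
  have hzx : z ≠ x := hzx
  rw [mem_rotatedHyperplane_iff] at hz
  have hcut : ∀ a : ℝ, 0 < a → ∃ k : ℕ, 1 / ((k : ℝ) + 1) ≤ a ∧ z ∈ Metric.closedBall (0 : E n) k := by
    intro a ha
    obtain ⟨k₁, h1⟩ := exists_nat_one_div_lt ha
    obtain ⟨k₂, h2⟩ := exists_nat_ge ‖z‖
    refine ⟨max k₁ k₂, (one_div_le_one_div_of_le (by positivity) ?_).trans h1.le, ?_⟩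
    · push_cast
      gcongr
      exact le_max_left _ _
    · rw [mem_closedBall_zero_iff]
      push_cast
      exact h2.trans (le_max_right _ _)
  by_cases hfoot : z = x + r • T.normal
  · have hr : 0 < r := by
      refine (hK x r T hT).lt_of_ne ?_
      rintro rfl
      exact hzx (by simpa using hfoot)
    obtain ⟨k, h1, h2⟩ := hcut r hr
    exact Or.inl (Set.mem_iUnion.2 ⟨k, (x, r, T), hT, hfoot, h1, h2⟩)
  · refine Or.inr ?_
    obtain ⟨j, hj⟩ : ∃ j, (z - (x + r • T.normal)) j ≠ 0 := by
      by_contra! h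
      exact hfoot (sub_eq_zero.1 (by ext j; exact h j))
    have hin : ∀ s : ℝ, inner ℝ (z - (x + r • T.normal)) (EuclideanSpace.single j s) =
        s * (z - (x + r • T.normal)) j := by
      intro s
      rw [EuclideanSpace.inner_single_right, conj_trivial]
    simp only [Set.mem_iUnion]
    obtain ⟨k, h1, h2⟩ := hcut _ (abs_pos.2 hj)
    refine ⟨j, k, ?_⟩
    rcases lt_or_gt_of_ne hj with hneg | hpos
    · refine Or.inr ⟨(x, r, T), hT, hz, ?_, h2⟩
      rw [abs_of_neg hneg] at h1
      dsimp only
      rw [hin]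
      linarith
    · refine Or.inl ⟨(x, r, T), hT, hz, ?_, h2⟩
      rw [abs_of_pos hpos] at h1
      dsimp only
      rw [hin]
      linarith

theorem typically_volume_arrangement_eq_zero [MetricSpace (SO n)] (hn : 2 ≤ n)
    (hm : InducesNaturalTopology n) {J : Set (E n × ℝ)} (hJ : IsCompact J)
    (hJ0 : ∀ p ∈ J, 0 ≤ p.2) :
    Typically fun K : CodeSpace J =>
      volume (arrangement (K.1 : Set (E n × ℝ × SO n))) = 0 := by
  have h1 : ∀ᶠ K : CodeSpace J in residual _, ∀ k : ℕ,
      volume (imageUnder (footRelation n (1 / ((k : ℝ) + 1)) k)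
        (K.1 : Set (E n × ℝ × SO n))) = 0 := by
    rw [eventually_countable_forall]
    intro k
    exact typically_volume_imageUnder_eq_zero (isClosed_footRelation hm _ _)
      (isCompact_closedBall 0 (k : ℝ)) (fun p z h => h.2.2)
      (locallySmall_footRelation hn hm hJ (by positivity) _)
  have h2 : ∀ s : ℝ, s * s = 1 → ∀ᶠ K : CodeSpace J in residual _, ∀ (j : Fin n) (k : ℕ),
      volume (imageUnder (displacementRelation (EuclideanSpace.single j s) (1 / ((k : ℝ) + 1)) k)
        (K.1 : Set (E n × ℝ × SO n))) = 0 := by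
    intro s hs
    simp only [eventually_countable_forall]
    intro j k
    exact typically_volume_imageUnder_eq_zero (isClosed_displacementRelation hm _ _ _)
      (isCompact_closedBall 0 (k : ℝ)) (fun p z h => h.2.2)
      (locallySmall_displacementRelation hn hm hJ hJ0 j hs (by positivity) (by positivity))
  refine (h1.and ((h2 1 (by norm_num)).and (h2 (-1) (by norm_num)))).mono ?_
  rintro K ⟨k1, k2, k3⟩
  refine measure_mono_null (arrangement_subset fun x r T h => hJ0 _ (K.2.1 x r T h)) ?_
  refine measure_union_null (measure_iUnion_null k1) (measure_iUnion_null fun j =>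
    measure_iUnion_null fun k => measure_union_null (k2 j k) (k3 j k))

end Nikodym

theorem theorem5p1 (n : ℕ) [NeZero n] (hn : 2 ≤ n)
    [MetricSpace (Nikodym.SO n)] (hmetric : Nikodym.InducesNaturalTopology n) :
    (∀ J : Set (Nikodym.E n × ℝ), J.Nonempty → IsCompact J → (∀ p ∈ J, 0 ≤ p.2) →
      Nikodym.Typically fun K : Nikodym.CodeSpace J =>
        volume (Nikodym.arrangement (K.1 : Set (Nikodym.E n × ℝ × Nikodym.SO n))) = 0) ∧
    (∀ C : Set (Nikodym.E n), C.Nonempty → IsCompact C →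
      Nikodym.Typically fun K : Nikodym.CodeSpace (C ×ˢ ({0} : Set ℝ)) =>
        Nikodym.IsNikodymSet C
          (Nikodym.arrangement (K.1 : Set (Nikodym.E n × ℝ × Nikodym.SO n)))) := by
  refine ⟨fun J _ hJ hJ0 => Nikodym.typically_volume_arrangement_eq_zero hn hmetric hJ hJ0,
    fun C _ hC => ?_⟩
  have h := Nikodym.typically_volume_arrangement_eq_zero hn hmetric
    (hC.prod isCompact_singleton) (J := C ×ˢ ({0} : Set ℝ)) (by rintro p ⟨-, hp⟩; exact hp.ge)
  refine Filter.mem_of_superset h fun K hK => ⟨hK, ?_⟩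
  exact Nikodym.containsPuncturedHyperplanes_arrangement fun x hx => K.2.2 x 0 ⟨hx, rfl⟩
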